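/- For a group $G$, let the factorization semigroup $S_G=S(G,G)$ be the semigroup generated by letters $x_g$, $g\in G$, subject to the relations $$x_{a}\cdot x_{b}=x_{b}\cdot x_{b^{-1}ab},\qquad x_{a}\cdot x_{b}=x_{aba^{-1}}\cdot x_{a},\qquad x_a\cdot x_{\mathbf 1}=x_{\mathbf 1}\cdot x_a=x_a\qquad(a,b\in G).$$ In particular, $x_{\mathbf 1}$ is its unit. Let $\alpha:S_G\to G$ be the homomorphism with $\alpha(x_g)=g$ (the *product*), and let $\tau$ be the homomorphism from $S_G$ to the additive monoid of families of non-negative integers indexed by the conjugacy classes $C\neq\{\mathbf 1\}$ of $G$ (the *type*), where the $C$-component of $\tau(x_{g_1}\cdots x_{g_n})$ is the number of indices $i$ with $g_i\in C$. An element $s\in S_G$ is called *stabilizing* if $s\cdot s_1=s\cdot s_2$ for all $s_1,s_2\in S_G$ with $\tau(s_1)=\tau(s_2)$ and $\alpha(s_1)=\alpha(s_2)$; the semigroup $S_G$ is called *stable* if it possesses a stabilizing element. For a natural number $d$ let $\mathcal S_d$ be the symmetric group on $\{1,\dots,d\}$, let $\Sigma_d=S_{\mathcal S_d}$ and, for an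 integer $g\ge 0$, let $$h_{d,g}=s_{(1,2)}^{\,g+1}\cdot s_{(2,3)}\cdots s_{(d-1,d)}\in\Sigma_d,\qquad s_{(i,j)}=x_{(i,j)}^2,$$ be the Hurwitz element of genus $g$ (for $d\le 1$ the product is empty and $h_{d,g}$ is the unit). **Corollary 2.3.** For every natural number $d$, the Hurwitz element $h_{d,\lfloor d/2\rfloor}$ is a stabilizing element of $\Sigma_d$. In particular, the semigroup $\Sigma_d$ is stable. -/

import Mathlib

/-- The defining relations of the universal factorization semigroup `S_G = S(G, G)`, between words
in the letters `x_g`, `g ∈ G` (the letter `x_g` is `FreeSemigroup.of g`).  For `a = b`, and for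
a trivial letter in the first two families, the first two families only contain trivialities or
consequences of the other two. -/
inductive FactorizationRel (G : Type*) [Group G] : FreeSemigroup G → FreeSemigroup G → Prop
  | left (a b : G) :
      FactorizationRel G (FreeSemigroup.of a * FreeSemigroup.of b)
        (FreeSemigroup.of b * FreeSemigroup.of (b⁻¹ * a * b))
  | right (a b : G) :
      FactorizationRel G (FreeSemigroup.of a * FreeSemigroup.of b)
        (FreeSemigroup.of (a * b * a⁻¹) * FreeSemigroup.of a)
  | mul_unit (a : G) :
      FactorizationRel G (FreeSemigroup.of a * FreeSemigroup.of 1) (FreeSemigroup.of a)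
  | unit_mul (a : G) :
      FactorizationRel G (FreeSemigroup.of 1 * FreeSemigroup.of a) (FreeSemigroup.of a)

/-- The factorization semigroup `S_G = S(G, G)` of a group `G` with factors in `G`: the semigroup
with generators `x_g`, `g ∈ G`, and the relations `FactorizationRel G`. -/
def FactorizationSemigroup (G : Type*) [Group G] : Type _ :=
  (conGen (FactorizationRel G)).Quotient

namespace FactorizationSemigroup

variable {G : Type*} [Group G]

instance instSemigroup : Semigroup (FactorizationSemigroup G) :=
  inferInstanceAs (Semigroup (conGen (FactorizationRel G)).Quotient)

/-- The element of `S_G` defined by a word. -/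
def mk : FreeSemigroup G →ₙ* FactorizationSemigroup G where
  toFun w := ((w : (conGen (FactorizationRel G)).Quotient))
  map_mul' _ _ := rfl

/-- The generator `x_g`. -/
def of (g : G) : FactorizationSemigroup G := mk (FreeSemigroup.of g)

theorem mk_surjective : Function.Surjective (mk : FreeSemigroup G → FactorizationSemigroup G) :=
  fun s => Quotient.exists_rep s

theorem mk_eq_of_rel {v w : FreeSemigroup G} (h : FactorizationRel G v w) : mk v = mk w :=
  (Con.eq _).2 (ConGen.Rel.of _ _ h)

theorem of_mul_of_one (a : G) : of a * of (1 : G) = of a :=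
  mk_eq_of_rel (FactorizationRel.mul_unit a)

theorem of_one_mul_of (a : G) : of (1 : G) * of a = of a :=
  mk_eq_of_rel (FactorizationRel.unit_mul a)

theorem unit_mul (s : FactorizationSemigroup G) : of 1 * s = s := by
  obtain ⟨w, rfl⟩ := mk_surjective s
  induction w using FreeSemigroup.recOnMul with
  | ih1 a => exact of_one_mul_of a
  | ih2 a w ha _ => rw [map_mul, ← mul_assoc, ha]

theorem mul_unit (s : FactorizationSemigroup G) : s * of 1 = s := by
  obtain ⟨w, rfl⟩ := mk_surjective s
  induction w using FreeSemigroup.recOnMul with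
  | ih1 a => exact of_mul_of_one a
  | ih2 a w _ hw => rw [map_mul, mul_assoc, hw]

/-- The letter `x_1` is the unit of the semigroup `S_G`. -/
instance instMonoid : Monoid (FactorizationSemigroup G) where
  one := of 1
  one_mul := unit_mul
  mul_one := mul_unit

/-- The homomorphism out of `S_G` determined by a map on the generators that respects the
defining relations. -/
def lift {M : Type*} [Monoid M] (f : G → M) (h1 : f 1 = 1)
    (hl : ∀ a b, f a * f b = f b * f (b⁻¹ * a * b))
    (hr : ∀ a b, f a * f b = f (a * b * a⁻¹) * f a) : FactorizationSemigroup G →* M where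
  toFun s := Con.liftOn s (FreeSemigroup.lift f) (by
    have h : conGen (FactorizationRel G) ≤ Con.ker (FreeSemigroup.lift f) := by
      refine Con.conGen_le.2 fun v w hvw => ?_
      cases hvw with
      | left a b => simpa [Con.ker_rel] using hl a b
      | right a b => simpa [Con.ker_rel] using hr a b
      | mul_unit a => simp [Con.ker_rel, h1]
      | unit_mul a => simp [Con.ker_rel, h1]
    exact fun v w hvw => h hvw)
  map_one' := h1
  map_mul' s t := by
    obtain ⟨v, rfl⟩ := mk_surjective s
    obtain ⟨w, rfl⟩ := mk_surjective t
    exact map_mul (FreeSemigroup.lift f) v w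

/-- The product homomorphism `α : S_G → G`, `α(x_g) = g`. -/
def prodHom : FactorizationSemigroup G →* G :=
  lift id rfl (fun a b => by simp [mul_assoc]) (fun a b => by simp)

theorem mk_conj_right (a b : G) : ConjClasses.mk (b⁻¹ * a * b) = ConjClasses.mk a :=
  ConjClasses.mk_eq_mk_iff_isConj.2 (isConj_iff.2 ⟨b, by group⟩)

theorem mk_conj_left (a b : G) : ConjClasses.mk (a * b * a⁻¹) = ConjClasses.mk b :=
  ConjClasses.mk_eq_mk_iff_isConj.2 (isConj_iff.2 ⟨a⁻¹, by group⟩)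

open Classical in
/-- The type of a single letter `x_g`: the basis vector of the conjugacy class of `g` if `g ≠ 1`,
and zero if `g = 1`. -/
noncomputable def letterType (g : G) : {C : ConjClasses G // C ≠ 1} → ℕ :=
  fun C => if ConjClasses.mk g = C then 1 else 0

/-- The type homomorphism `τ` on `S_G`, with values in the additive monoid of vectors of natural
numbers indexed by the nontrivial conjugacy classes of `G`: the component of `τ(s)` at `C` is the
number of factors of `s` that lie in `C`. -/
noncomputable def typeHom :
    FactorizationSemigroup G →* Multiplicative ({C : ConjClasses G // C ≠ 1} → ℕ) :=
  lift (fun g => Multiplicative.ofAdd (letterType g))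
    (by
      rw [ofAdd_eq_one]
      funext C
      exact if_neg fun h => C.2 h.symm)
    (fun a b => by
      have h : letterType (b⁻¹ * a * b) = letterType a := by
        unfold letterType
        rw [mk_conj_right]
      rw [h, mul_comm])
    (fun a b => by
      have h : letterType (a * b * a⁻¹) = letterType b := by
        unfold letterType
        rw [mk_conj_left]
      rw [h, mul_comm])

/-- An element `s` of `S_G` is stabilizing if multiplication by `s` identifies any two elements
with the same type and the same product. -/
def IsStabilizing (s : FactorizationSemigroup G) : Prop :=
  ∀ s₁ s₂ : FactorizationSemigroup G,
    typeHom s₁ = typeHom s₂ → prodHom s₁ = prodHom s₂ → s * s₁ = s * s₂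

/-- The semigroup `S_G` is stable if it possesses a stabilizing element. -/
def IsStable (G : Type*) [Group G] : Prop :=
  ∃ s : FactorizationSemigroup G, IsStabilizing s

/-- The transposition of the `i`-th and the `(i + 1)`-st of the `d` points, counted from `0`. -/
def adjSwap (d : ℕ) (i : Fin (d - 1)) : Equiv.Perm (Fin d) :=
  Equiv.swap ⟨i, by omega⟩ ⟨i + 1, by omega⟩

/-- The Hurwitz element `h_{d,g} = s_{(1,2)}^{g+1} · s_{(2,3)} · … · s_{(d-1,d)}` of genus `g` in
`Σ_d = S(𝒮_d, 𝒮_d)`, where `s_{(i,j)} = x_{(i,j)}^2`.  The points are numbered from `0` here. -/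
def hurwitzElement (d g : ℕ) : FactorizationSemigroup (Equiv.Perm (Fin d)) :=
  ((List.finRange (d - 1)).map fun i =>
    (of (adjSwap d i) ^ 2) ^ (if (i : ℕ) = 0 then g + 1 else 1)).prod

end FactorizationSemigroup

/-! For `d ≥ 2` put `K = hurwitzElement d 0` and let `z` be the squared letter of the first adjacent
transposition; the element in question is `K * z ^ (d / 2)`. Squared letters of transpositions are
central, and next to a letter `a` such a square may be conjugated by `a`. Since `K` contains the
square of every adjacent transposition, and these generate, `K` identifies all squared
transpositions with `z` (`hurwitzElement_absorbsSwaps`). The Clebsch–Hurwitz reduction then shows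
that over `K` a word in transpositions depends only on its length and product
(`AbsorbsSwaps.mul_ofList_eq`).

The factor `z ^ (d / 2)` is a word of `2 * (d / 2)` transpositions, long enough to be rewritten over
`K` so as to end in any given transposition. Passing that transposition around the next letter
conjugates this letter (`AbsorbsSwaps.exists_conj`). Equal types let the nontrivial letters of one
element be turned one by one into those of the other; what remains are two transposition words of
equal length, and of equal product because the total products agree. -/

namespace FactorizationSemigroup

/-! ### Words, types and central squares. -/

section Words

variable {G : Type*} [Group G]

theorem of_one : of (1 : G) = 1 := rfl

theorem of_mul_of (a b : G) : of a * of b = of b * of (b⁻¹ * a * b) :=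
  mk_eq_of_rel (FactorizationRel.left a b)

theorem of_mul_of' (a b : G) : of a * of b = of (a * b * a⁻¹) * of a :=
  mk_eq_of_rel (FactorizationRel.right a b)

theorem prodHom_of (a : G) : prodHom (of a) = a := rfl

theorem typeHom_of (a : G) : typeHom (of a) = Multiplicative.ofAdd (letterType a) := rfl

/-- The element of `S_G` defined by a list of letters. -/
def ofList (l : List G) : FactorizationSemigroup G := (l.map of).prod

@[simp] theorem ofList_nil : ofList ([] : List G) = 1 := rfl

@[simp] theorem ofList_cons (a : G) (l : List G) : ofList (a :: l) = of a * ofList l := by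
  simp [ofList]

@[simp] theorem ofList_append (l l' : List G) : ofList (l ++ l') = ofList l * ofList l' := by
  simp [ofList]

theorem prodHom_ofList (l : List G) : prodHom (ofList l) = l.prod := by
  induction l with
  | nil => simp
  | cons a l ih => simp [ih, prodHom_of]

theorem ofList_surjective : Function.Surjective (ofList : List G → FactorizationSemigroup G) := by
  intro s
  obtain ⟨w, rfl⟩ := mk_surjective s
  induction w using FreeSemigroup.recOnMul with
  | ih1 a => exact ⟨[a], by simp [of]⟩
  | ih2 a w ha hw =>
    obtain ⟨l, hl⟩ := hw
    exact ⟨a :: l, by rw [ofList_cons, hl, map_mul, of]⟩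

theorem ofList_mul_of (l : List G) (b : G) :
    ofList l * of b = of b * ofList (l.map fun a => b⁻¹ * a * b) := by
  induction l with
  | nil => simp
  | cons a l ih => rw [ofList_cons, mul_assoc, ih, ← mul_assoc, of_mul_of, List.map_cons,
      ofList_cons, mul_assoc]

theorem letterType_apply_self {a : G} (ha : ConjClasses.mk a ≠ 1) :
    letterType a ⟨ConjClasses.mk a, ha⟩ = 1 := by
  simp [letterType]

theorem typeHom_of_mul_apply (a : G) (s : FactorizationSemigroup G)
    (C : {C : ConjClasses G // C ≠ 1}) :
    Multiplicative.toAdd (typeHom (of a * s)) C =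
      letterType a C + Multiplicative.toAdd (typeHom s) C := by
  rw [map_mul, typeHom_of]
  rfl

theorem eq_one_of_typeHom_eq_one {s : FactorizationSemigroup G} (h : typeHom s = 1) : s = 1 := by
  obtain ⟨l, rfl⟩ := ofList_surjective s
  induction l with
  | nil => rfl
  | cons a l ih =>
    have h' (C) : letterType a C + Multiplicative.toAdd (typeHom (ofList l)) C = 0 := by
      rw [← typeHom_of_mul_apply, ← ofList_cons, h]
      rfl
    have ha : a = 1 := by
      by_contra ha
      have hc : ConjClasses.mk a ≠ 1 := by
        rw [ConjClasses.one_eq_mk_one, Ne, ConjClasses.mk_eq_mk_iff_isConj]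
        exact fun hc => ha (isConj_one_left.1 hc)
      have := h' ⟨_, hc⟩
      rw [letterType_apply_self] at this
      omega
    have hl : typeHom (ofList l) = 1 := by
      rw [← ofAdd_toAdd (typeHom (ofList l)), ofAdd_eq_one]
      funext C
      exact (Nat.add_eq_zero_iff.1 (h' C)).2
    rw [ofList_cons, ih hl, ha, of_one, one_mul]

/-- A letter can be pulled to the front unchanged, at the cost of conjugating the letters it passes.
-/
theorem exists_eq_of_mul_of_typeHom_ne_zero {s : FactorizationSemigroup G}
    {C : {C : ConjClasses G // C ≠ 1}} (h : Multiplicative.toAdd (typeHom s) C ≠ 0) :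
    ∃ a s', ConjClasses.mk a = C ∧ s = of a * s' := by
  obtain ⟨l, rfl⟩ := ofList_surjective s
  induction l with
  | nil => exact (h (by rw [ofList_nil, map_one]; rfl)).elim
  | cons b l ih =>
    by_cases hb : ConjClasses.mk b = C
    · exact ⟨b, ofList l, hb, ofList_cons b l⟩
    · rw [ofList_cons, typeHom_of_mul_apply] at h
      obtain ⟨a, s', ha, hs⟩ := ih (by simpa [letterType, hb] using h)
      exact ⟨a, of (a⁻¹ * b * a) * s', ha, by
        rw [ofList_cons, hs, ← mul_assoc, of_mul_of, mul_assoc]⟩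

theorem letterType_conj {a b : G} (h : ConjClasses.mk a = ConjClasses.mk b) :
    letterType a = letterType b := by
  funext C
  unfold letterType
  rw [h]

/-- The square of the letter of an involution is central. -/
theorem of_sq_commute {t : G} (ht : t * t = 1) (s : FactorizationSemigroup G) :
    Commute (of t ^ 2) s := by
  obtain ⟨l, rfl⟩ := ofList_surjective s
  induction l with
  | nil => exact Commute.one_right _
  | cons a l ih =>
    rw [ofList_cons]
    refine Commute.mul_right ?_ ih
    have hi : t⁻¹ = t := inv_eq_of_mul_eq_one_left ht
    have h : t * (t * a * t) * t = a := by
      rw [show t * (t * a * t) * t = t * t * a * (t * t) by simp only [mul_assoc], ht]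
      simp
    -- Passing two letters `t` conjugates `a` twice by an involution, which restores it.
    have key : of a * (of t * of t) = of t * of t * of a := by
      rw [← mul_assoc, of_mul_of a t, mul_assoc, of_mul_of _ t, hi, h, mul_assoc]
    rw [Commute, SemiconjBy, pow_two, key]

/-- Centrality carries the square to the right of `a` unchanged; bringing it back letter by letter
conjugates it. -/
theorem of_sq_mul_of {t : G} (ht : t * t = 1) (a : G) :
    of t ^ 2 * of a = of (a * t * a⁻¹) ^ 2 * of a := by
  rw [(of_sq_commute ht (of a)).eq, pow_two, pow_two, ← mul_assoc, of_mul_of' a t,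
    mul_assoc (of (a * t * a⁻¹)) (of a), of_mul_of' a t, ← mul_assoc]

end Words

section Swaps

open Equiv Equiv.Perm

theorem swap_mul_self_of_isSwap {α : Type*} [DecidableEq α] {t : Perm α} (ht : t.IsSwap) :
    t * t = 1 := by
  obtain ⟨x, y, -, rfl⟩ := ht
  exact swap_mul_self x y

theorem isSwap_conj {α : Type*} [DecidableEq α] {t : Perm α} (ht : t.IsSwap) (g : Perm α) :
    (g * t * g⁻¹).IsSwap := by
  obtain ⟨x, y, hxy, rfl⟩ := ht
  refine ⟨g x, g y, g.injective.ne hxy, ?_⟩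
  rw [← swap_apply_apply]

theorem isSwap_conj' {α : Type*} [DecidableEq α] {t : Perm α} (ht : t.IsSwap) (g : Perm α) :
    (g⁻¹ * t * g).IsSwap := by
  simpa using isSwap_conj ht g⁻¹

theorem eq_swap_of_isSwap {α : Type*} [DecidableEq α] {t : Perm α} (ht : t.IsSwap) {p : α}
    (hp : t p ≠ p) : t = swap (t p) p := by
  obtain ⟨x, y, -, rfl⟩ := ht
  by_cases h1 : p = x
  · subst h1
    rw [swap_apply_left, swap_comm]
  · by_cases h2 : p = y
    · subst h2
      rw [swap_apply_right]
    · exact absurd (swap_apply_of_ne_of_ne h1 h2) hp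

theorem prod_apply_of_forall {α : Type*} {l : List (Perm α)} {x : α} (h : ∀ t ∈ l, t x = x) :
    l.prod x = x := by
  induction l with
  | nil => rfl
  | cons t l ih =>
    rw [List.prod_cons, Perm.mul_apply, ih fun u hu => h u (by simp [hu]), h t (by simp)]

theorem sign_prod_of_isSwap {α : Type*} [DecidableEq α] [Fintype α] {l : List (Perm α)}
    (h : ∀ t ∈ l, t.IsSwap) : sign l.prod = (-1) ^ l.length :=
  sign_prod_list_swap h

/-! ### Clebsch–Hurwitz normal form over an absorbing element. -/

variable {d : ℕ}

/-- A central element of `Σ_d` that identifies all squares of transpositions, as the product of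
the squares of the adjacent transpositions does. -/
structure AbsorbsSwaps (K z : FactorizationSemigroup (Perm (Fin d))) : Prop where
  commute : ∀ s, Commute K s
  commute' : ∀ s, Commute z s
  prodHom_eq : prodHom z = 1
  mul_sq : ∀ t : Perm (Fin d), t.IsSwap → K * of t ^ 2 = K * z

variable {K z : FactorizationSemigroup (Perm (Fin d))}

theorem AbsorbsSwaps.mul_pow_mul (hK : AbsorbsSwaps K z) (m : ℕ)
    {a b : FactorizationSemigroup (Perm (Fin d))} (h : K * a = K * b) :
    K * z ^ m * a = K * z ^ m * b := by
  rw [hK.commute, mul_assoc, h, ← mul_assoc]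

theorem AbsorbsSwaps.mul_mul (hK : AbsorbsSwaps K z)
    (x : FactorizationSemigroup (Perm (Fin d)))
    {a b : FactorizationSemigroup (Perm (Fin d))} (h : K * a = K * b) :
    K * (x * a) = K * (x * b) := by
  rw [← mul_assoc, hK.commute, mul_assoc, h, ← mul_assoc, ← (hK.commute x).eq, mul_assoc]

/-- Over an absorbing element, at most one transposition moving the largest point is needed. -/
theorem AbsorbsSwaps.exists_reduce (hK : AbsorbsSwaps K z) {n : ℕ} (hn : n < d)
    (l : List (Perm (Fin d)))
    (hl : ∀ t ∈ l, t.IsSwap ∧ ∀ i : Fin d, n + 1 ≤ (i : ℕ) → t i = i) :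
    ∃ (m : ℕ) (e l' : List (Perm (Fin d))),
      (∀ t ∈ l', t.IsSwap ∧ ∀ i : Fin d, n ≤ (i : ℕ) → t i = i) ∧
      (e = [] ∨ ∃ j : Fin d, (j : ℕ) < n ∧ e = [swap j ⟨n, hn⟩]) ∧
      l.length = 2 * m + e.length + l'.length ∧
      K * ofList l = K * z ^ m * ofList e * ofList l' := by
  induction l with
  | nil => exact ⟨0, [], [], by simp, Or.inl rfl, by simp, by simp⟩
  | cons t l ih =>
    obtain ⟨m, e, l', hl', he, hlen, heq⟩ := ih fun u hu => hl u (by simp [hu])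
    obtain ⟨ht, htf⟩ := hl t (by simp)
    set p : Fin d := ⟨n, hn⟩ with hp
    have hz (s) : of t * (K * z ^ m * s) = K * z ^ m * (of t * s) := by
      rw [← mul_assoc, ← (hK.commute (of t)).mul_left ((hK.commute' (of t)).pow_left m), mul_assoc]
    have h0 : K * ofList (t :: l) = K * z ^ m * (of t * (ofList e * ofList l')) := by
      rw [ofList_cons, ← mul_assoc, hK.commute (of t), mul_assoc, heq, mul_assoc (K * z ^ m), hz]
    rw [h0]
    have hlt (i : Fin d) (hi : i ≠ p) (h : ¬ n + 1 ≤ (i : ℕ)) : (i : ℕ) < n := by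
      have : (i : ℕ) ≠ n := fun h => hi (Fin.ext h)
      omega
    -- If `t` fixes `p`, it moves past `e`, which is conjugated to another transposition moving `p`.
    by_cases htp : t p = p
    · have htf' (i : Fin d) (hi : n ≤ (i : ℕ)) : t i = i := by
        by_cases h : n + 1 ≤ (i : ℕ)
        · exact htf i h
        · rw [show i = p from Fin.ext (by simp [hp]; omega), htp]
      have hl2 : ∀ u ∈ t :: l', u.IsSwap ∧ ∀ i : Fin d, n ≤ (i : ℕ) → u i = i := by
        intro u hu
        rcases List.mem_cons.1 hu with rfl | hu
        · exact ⟨ht, htf'⟩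
        · exact hl' u hu
      rcases he with rfl | ⟨j, hj, rfl⟩
      · exact ⟨m, [], t :: l', hl2, Or.inl rfl, by simp at hlen ⊢; omega, by simp⟩
      · refine ⟨m, [swap (t j) p], t :: l', hl2, Or.inr ⟨t j, ?_, rfl⟩,
          by simp at hlen ⊢; omega, ?_⟩
        · by_contra h
          have := t.injective (htf' (t j) (by omega))
          rw [this] at h
          exact h hj
        · have : swap (t j) p = t * swap j p * t⁻¹ := by
            rw [← swap_apply_apply, htp]
          rw [this]
          simp only [ofList_cons, ofList_nil, mul_one]
          rw [← mul_assoc (of t), of_mul_of' t]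
          simp only [mul_assoc]
    · have hti : ((t p : Fin d) : ℕ) < n := by
        refine hlt _ htp fun h => htp ?_
        exact t.injective (htf (t p) h)
      have htsw := eq_swap_of_isSwap ht htp
      rcases he with rfl | ⟨j, hj, rfl⟩
      · exact ⟨m, [t], l', hl', Or.inr ⟨t p, hti, by rw [← htsw]⟩,
          by simp at hlen ⊢; omega, by simp [mul_assoc]⟩
      -- Two letters moving `p`: equal ones form a square, absorbed as `z`; for distinct ones,
      -- pulling `e` forward conjugates `t` into a transposition fixing `p`.
      · by_cases hij : t p = j
        · refine ⟨m + 1, [], l', hl', Or.inl rfl, by simp at hlen ⊢; omega, ?_⟩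
          rw [← hij, ← htsw]
          simp only [ofList_cons, ofList_nil, mul_one]
          rw [← mul_assoc (of t), ← pow_two, ← mul_assoc, hK.mul_pow_mul m (hK.mul_sq t ht),
            pow_succ, ← mul_assoc K]
        · refine ⟨m, [swap j p], swap j (t p) :: l', ?_, Or.inr ⟨j, hj, rfl⟩,
            by simp at hlen ⊢; omega, ?_⟩
          · intro u hu
            rcases List.mem_cons.1 hu with rfl | hu
            · refine ⟨⟨j, t p, Ne.symm hij, rfl⟩, fun i hi => swap_apply_of_ne_of_ne ?_ ?_⟩
              · rintro rfl
                omega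
              · rintro rfl
                omega
            · exact hl' u hu
          · have hjp : j ≠ p := by
              intro h
              rw [h] at hj
              simp [hp] at hj
            have : swap j (t p) = (swap j p)⁻¹ * t * swap j p := by
              have h := swap_apply_apply (swap j p)⁻¹ (t p) p
              rwa [inv_inv, ← htsw, swap_inv, swap_apply_right,
                swap_apply_of_ne_of_ne hij htp, swap_comm] at h
            rw [this]
            simp only [ofList_cons, ofList_nil, mul_one]
            rw [← mul_assoc (of t), of_mul_of t]
            simp only [mul_assoc]

/-- The normal form of words in transpositions over an absorbing element. -/
theorem AbsorbsSwaps.exists_normalForm (hK : AbsorbsSwaps K z) (n : ℕ) (hn : n ≤ d)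
    (σ : Perm (Fin d)) (hσ : ∀ i : Fin d, n ≤ (i : ℕ) → σ i = i) :
    ∃ c : List (Perm (Fin d)), (∀ t ∈ c, t.IsSwap) ∧ c.prod = σ ∧ c.length ≤ n - 1 ∧
      ∀ l : List (Perm (Fin d)),
        (∀ t ∈ l, t.IsSwap ∧ ∀ i : Fin d, n ≤ (i : ℕ) → t i = i) → l.prod = σ →
        ∃ m, l.length = 2 * m + c.length ∧ K * ofList l = K * z ^ m * ofList c := by
  induction n generalizing σ with
  | zero =>
    refine ⟨[], by simp, ?_, by simp, fun l hl _ => ?_⟩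
    · ext i
      simp [hσ i (Nat.zero_le _)]
    · cases l with
      | nil => exact ⟨0, by simp, by simp⟩
      | cons t l =>
        obtain ⟨⟨x, y, hxy, rfl⟩, h⟩ := hl t (by simp)
        exact absurd (h x (Nat.zero_le _)).symm (by simpa using hxy)
  | succ n ih =>
    have hnd : n < d := hn
    set p : Fin d := ⟨n, hnd⟩ with hp
    have hfix (ρ : Perm (Fin d)) (h1 : ∀ i : Fin d, n + 1 ≤ (i : ℕ) → ρ i = i) (h2 : ρ p = p) :
        ∀ i : Fin d, n ≤ (i : ℕ) → ρ i = i := by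
      intro i hi
      by_cases h : n + 1 ≤ (i : ℕ)
      · exact h1 i h
      · rw [show i = p from Fin.ext (by simp [hp]; omega), h2]
    have hred (l : List (Perm (Fin d)))
        (hl : ∀ t ∈ l, t.IsSwap ∧ ∀ i : Fin d, n + 1 ≤ (i : ℕ) → t i = i) (hlσ : l.prod = σ) :
        ∃ (m : ℕ) (e l' : List (Perm (Fin d))),
          (∀ t ∈ l', t.IsSwap ∧ ∀ i : Fin d, n ≤ (i : ℕ) → t i = i) ∧
          (e = [] ∧ σ p = p ∨ σ p ≠ p ∧ e = [swap (σ p) p]) ∧ σ = e.prod * l'.prod ∧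
          l.length = 2 * m + e.length + l'.length ∧
          K * ofList l = K * z ^ m * ofList e * ofList l' := by
      obtain ⟨m, e, l', hl', he, hlen, heq⟩ := hK.exists_reduce hnd l hl
      have hprod := congrArg prodHom heq
      simp only [map_mul, map_pow, hK.prodHom_eq, prodHom_ofList, one_pow, one_mul,
        mul_assoc, mul_right_inj] at hprod
      rw [hlσ] at hprod
      -- Hence `σ p` alone determines `e`, so one `c` serves all words `l`.
      have hp' : l'.prod p = p := prod_apply_of_forall fun t ht => (hl' t ht).2 p le_rfl
      refine ⟨m, e, l', hl', ?_, hprod, hlen, heq⟩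
      have hσp : σ p = e.prod p := by rw [hprod, Perm.mul_apply, hp']
      rcases he with rfl | ⟨j, hj, rfl⟩
      · exact Or.inl ⟨rfl, hσp⟩
      · simp only [List.prod_singleton, ← hp, swap_apply_right] at hσp
        refine Or.inr ⟨?_, by rw [hσp]⟩
        rw [hσp]
        rintro rfl
        exact lt_irrefl n hj
    by_cases hσp : σ p = p
    · obtain ⟨c, hc, hcσ, hcn, hcl⟩ := ih hnd.le σ (hfix σ hσ hσp)
      refine ⟨c, hc, hcσ, by omega, fun l hl hlσ => ?_⟩
      obtain ⟨m, e, l', hl', he, hprod, hlen, heq⟩ := hred l hl hlσ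
      obtain ⟨rfl, -⟩ : e = [] ∧ σ p = p := he.resolve_right fun h => h.1 hσp
      obtain ⟨m', hlen', heq'⟩ := hcl l' hl' (by simpa using hprod.symm)
      refine ⟨m + m', by simp at hlen; omega, ?_⟩
      rw [mul_assoc] at heq'
      rw [heq, ofList_nil, mul_one, hK.mul_pow_mul m heq', pow_add]
      simp only [mul_assoc]
    -- For `n = 0` the truncated bound `n - 1` would leave no room for the extra letter.
    · have hpos : 0 < n := by
        by_contra h
        refine hσp (Fin.ext ?_)
        have hn0 : n = 0 := by omega
        by_contra h'
        have h3 : n + 1 ≤ ((σ p : Fin d) : ℕ) := by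
          have hpn : (p : ℕ) = n := rfl
          omega
        exact hσp (σ.injective (hσ _ h3))
      have hσf (i : Fin d) (hi : n + 1 ≤ (i : ℕ)) : (swap (σ p) p * σ) i = i := by
        rw [Perm.mul_apply, hσ i hi, swap_apply_of_ne_of_ne]
        · rintro rfl
          have := σ.injective (hσ _ hi)
          rw [this] at hi
          simp [hp] at hi
        · rintro rfl
          simp [hp] at hi
      obtain ⟨c, hc, hcσ, hcn, hcl⟩ := ih hnd.le (swap (σ p) p * σ)
        (hfix _ hσf (by rw [Perm.mul_apply, swap_apply_left]))
      refine ⟨swap (σ p) p :: c, ?_, ?_, ?_, fun l hl hlσ => ?_⟩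
      · intro t ht
        rcases List.mem_cons.1 ht with rfl | ht
        · exact ⟨_, _, hσp, rfl⟩
        · exact hc t ht
      · rw [List.prod_cons, hcσ, swap_mul_self_mul]
      · simp
        omega
      · obtain ⟨m, e, l', hl', he, hprod, hlen, heq⟩ := hred l hl hlσ
        obtain ⟨-, rfl⟩ := he.resolve_left fun h => hσp h.2
        obtain ⟨m', hlen', heq'⟩ := hcl l' hl' (by
          rw [List.prod_singleton] at hprod
          rw [← swap_inv, eq_inv_mul_iff_mul_eq]
          exact hprod.symm)
        refine ⟨m + m', by simp at hlen ⊢; omega, ?_⟩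
        rw [mul_assoc] at heq'
        rw [heq, mul_assoc, hK.mul_pow_mul m (hK.mul_mul _ heq'), ← mul_assoc (ofList [_]),
          ← ((hK.commute' _).pow_left m').eq, pow_add, ofList_cons, ofList_cons]
        simp only [ofList_nil, mul_one, mul_assoc]

/-- Over an absorbing element, a word in transpositions is determined by its length and its
product. -/
theorem AbsorbsSwaps.mul_ofList_eq (hK : AbsorbsSwaps K z) {l l' : List (Perm (Fin d))}
    (hl : ∀ t ∈ l, t.IsSwap) (hl' : ∀ t ∈ l', t.IsSwap) (hlen : l.length = l'.length)
    (hprod : l.prod = l'.prod) : K * ofList l = K * ofList l' := by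
  have hd (σ : Perm (Fin d)) (i : Fin d) (hi : d ≤ (i : ℕ)) : σ i = i :=
    absurd i.2 (not_lt.2 hi)
  obtain ⟨c, -, -, -, h⟩ := hK.exists_normalForm d le_rfl l.prod (hd _)
  obtain ⟨m, hm, hm'⟩ := h l (fun t ht => ⟨hl t ht, hd t⟩) rfl
  obtain ⟨m₂, hm₂, hm₂'⟩ := h l' (fun t ht => ⟨hl' t ht, hd t⟩) hprod.symm
  rw [hm', hm₂', show m = m₂ by omega]

/-! ### Conjugating letters by means of transposition words. -/

theorem AbsorbsSwaps.exists_word (hK : AbsorbsSwaps K z) {t : Perm (Fin d)} (ht : t.IsSwap)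
    (σ : Perm (Fin d)) (k : ℕ) (hk : d ≤ k + 2) (hσ : sign σ = (-1) ^ k) :
    ∃ l : List (Perm (Fin d)), (∀ u ∈ l, u.IsSwap) ∧ l.length = k ∧ l.prod = σ := by
  obtain ⟨c, hc, hcσ, hcd, -⟩ := hK.exists_normalForm d le_rfl σ
    fun i hi => absurd i.2 (not_lt.2 hi)
  -- The bound only gives `c.length ≤ k + 1`; parity excludes equality, and the even gap `k -
  -- c.length = 2 * (k - r)` is padded with copies of `t`.
  have hpar : Even (c.length + k) := by
    have h1 : (-1 : ℤˣ) ^ (c.length + k) = 1 := by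
      rw [pow_add, ← hσ, ← hcσ, ← sign_prod_of_isSwap hc, Int.units_mul_self]
    exact (neg_one_pow_eq_one_iff_even (by decide)).1 h1
  obtain ⟨r, hr⟩ := hpar
  refine ⟨c ++ List.replicate (2 * (k - r)) t, fun u hu => ?_, ?_, ?_⟩
  · rcases List.mem_append.1 hu with hu | hu
    · exact hc u hu
    · rwa [List.eq_of_mem_replicate hu]
  · rw [List.length_append, List.length_replicate]
    omega
  · rw [List.prod_append, List.prod_replicate, pow_mul, pow_two, swap_mul_self_of_isSwap ht,
      one_pow, mul_one, hcσ]

theorem AbsorbsSwaps.exists_conj_swap (hK : AbsorbsSwaps K z) {t : Perm (Fin d)} (ht : t.IsSwap)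
    (a : Perm (Fin d)) {l : List (Perm (Fin d))} (hl : ∀ u ∈ l, u.IsSwap)
    (hlen : l.length = 2 * (d / 2)) :
    ∃ l' : List (Perm (Fin d)), (∀ u ∈ l', u.IsSwap) ∧ l'.length = 2 * (d / 2) ∧
      K * (ofList l * of a) = K * (ofList l' * of (t * a * t⁻¹)) := by
  have hd : 2 ≤ d := by
    obtain ⟨x, y, hxy, -⟩ := ht
    have := Fin.val_ne_of_ne hxy
    omega
  have hsign : sign (l.prod * t) = (-1) ^ (2 * (d / 2) - 1) := by
    rw [Perm.sign_mul, sign_prod_of_isSwap hl, ht.sign_eq, hlen, ← pow_succ,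
      show 2 * (d / 2) + 1 = 2 * (d / 2) - 1 + 2 by omega, pow_add]
    simp
  obtain ⟨w, hw, hwlen, hwprod⟩ := hK.exists_word ht (l.prod * t) _ (by omega) hsign
  -- With the word ending in `t`, the `right` relation is applied twice to `t, a`: first `a`, then
  -- `t` is conjugated.
  refine ⟨w ++ [t * a * t⁻¹ * t * (t * a * t⁻¹)⁻¹], ?_, ?_, ?_⟩
  · intro u hu
    rcases List.mem_append.1 hu with hu | hu
    · exact hw u hu
    · rw [List.mem_singleton.1 hu]
      exact isSwap_conj ht _
  · rw [List.length_append, hwlen, List.length_singleton]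
    omega
  · have h : K * ofList l = K * ofList (w ++ [t]) := by
      refine hK.mul_ofList_eq hl ?_ ?_ ?_
      · intro u hu
        rcases List.mem_append.1 hu with hu | hu
        · exact hw u hu
        · rwa [List.mem_singleton.1 hu]
      · rw [List.length_append, hwlen, hlen, List.length_singleton]
        omega
      · rw [List.prod_append, hwprod, List.prod_singleton, mul_assoc,
          swap_mul_self_of_isSwap ht, mul_one]
    rw [← mul_assoc, h]
    simp only [ofList_append, ofList_cons, ofList_nil, mul_one]
    rw [mul_assoc K, mul_assoc (ofList w), of_mul_of' t a, of_mul_of' (t * a * t⁻¹) t,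
      mul_assoc (ofList w)]

/-- Over an absorbing element and a sufficiently long word in transpositions, a letter can be
replaced by any of its conjugates. -/
theorem AbsorbsSwaps.exists_conj (hK : AbsorbsSwaps K z) (g a : Perm (Fin d))
    {l : List (Perm (Fin d))} (hl : ∀ u ∈ l, u.IsSwap) (hlen : l.length = 2 * (d / 2)) :
    ∃ l' : List (Perm (Fin d)), (∀ u ∈ l', u.IsSwap) ∧ l'.length = 2 * (d / 2) ∧
      K * (ofList l * of a) = K * (ofList l' * of (g * a * g⁻¹)) := by
  induction g using swap_induction_on with
  | one => exact ⟨l, hl, hlen, by simp⟩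
  | swap_mul f x y hxy ih =>
    obtain ⟨l₁, h₁, hlen₁, heq₁⟩ := ih
    obtain ⟨l₂, h₂, hlen₂, heq₂⟩ :=
      hK.exists_conj_swap ⟨x, y, hxy, rfl⟩ (f * a * f⁻¹) h₁ hlen₁
    refine ⟨l₂, h₂, hlen₂, ?_⟩
    rw [heq₁, heq₂, mul_inv_rev]
    simp only [mul_assoc]

/-- The transposition words must vary independently for the induction: matching a letter `b` alters
one of them, and moving `b` to the front for cancellation conjugates both. -/
theorem AbsorbsSwaps.mul_ofList_mul_eq (hK : AbsorbsSwaps K z) (B : List (Perm (Fin d)))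
    (s : FactorizationSemigroup (Perm (Fin d))) {l l' : List (Perm (Fin d))}
    (hl : ∀ u ∈ l, u.IsSwap) (hlen : l.length = 2 * (d / 2))
    (hl' : ∀ u ∈ l', u.IsSwap) (hlen' : l'.length = 2 * (d / 2))
    (htype : typeHom s = typeHom (ofList B))
    (hprod : l.prod * prodHom s = l'.prod * B.prod) :
    K * (ofList l * s) = K * (ofList l' * ofList B) := by
  induction B generalizing s l l' with
  | nil =>
    obtain rfl := eq_one_of_typeHom_eq_one (htype.trans (map_one _))
    rw [ofList_nil, mul_one, mul_one]
    exact hK.mul_ofList_eq hl hl' (hlen.trans hlen'.symm) (by simpa using hprod)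
  | cons b B ih =>
    by_cases hb : b = 1
    · subst hb
      rw [ofList_cons, of_one, one_mul] at htype ⊢
      exact ih s hl hlen hl' hlen' htype (by simpa using hprod)
    have hC : ConjClasses.mk b ≠ 1 := by
      rw [ConjClasses.one_eq_mk_one, Ne, ConjClasses.mk_eq_mk_iff_isConj]
      exact fun hc => hb (isConj_one_left.1 hc)
    obtain ⟨a, s', ha, rfl⟩ := exists_eq_of_mul_of_typeHom_ne_zero (s := s)
      (C := ⟨ConjClasses.mk b, hC⟩) (by
        rw [htype, ofList_cons, typeHom_of_mul_apply, letterType_apply_self hC]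
        omega)
    obtain ⟨g, rfl⟩ := isConj_iff.1 (ConjClasses.mk_eq_mk_iff_isConj.1 ha)
    obtain ⟨l₁, h₁, hlen₁, heq₁⟩ := hK.exists_conj g a hl hlen
    set b := g * a * g⁻¹ with hbdef
    have hprod₁ := congrArg prodHom heq₁
    simp only [map_mul, prodHom_ofList, prodHom_of, mul_right_inj] at hprod₁
    have hmap (w : List (Perm (Fin d))) : w.prod * b = b * (w.map fun u => b⁻¹ * u * b).prod := by
      simpa only [map_mul, prodHom_ofList, prodHom_of] using congrArg prodHom (ofList_mul_of w b)
    have hswap {w : List (Perm (Fin d))} (hw : ∀ u ∈ w, u.IsSwap) :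
        ∀ u ∈ w.map fun u => b⁻¹ * u * b, u.IsSwap := by
      intro u hu
      obtain ⟨v, hv, rfl⟩ := List.mem_map.1 hu
      exact isSwap_conj' (hw v hv) b
    have key := ih s' (hswap h₁) (by rw [List.length_map, hlen₁]) (hswap hl')
      (by rw [List.length_map, hlen']) (by
        rw [ofList_cons, map_mul, map_mul, typeHom_of, typeHom_of, letterType_conj ha] at htype
        exact mul_left_cancel htype) (by
        rw [map_mul, prodHom_of, ← mul_assoc, hprod₁, hmap, List.prod_cons, ← mul_assoc, hmap] at hprod
        rw [mul_assoc b, mul_assoc b] at hprod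
        exact mul_left_cancel hprod)
    rw [← mul_assoc (ofList l), ← mul_assoc, heq₁, ofList_cons, ← mul_assoc (ofList l'),
      ofList_mul_of, ofList_mul_of, mul_assoc, mul_assoc, mul_assoc]
    exact hK.mul_mul _ key

theorem AbsorbsSwaps.isStabilizing {t : Perm (Fin d)} (hK : AbsorbsSwaps K (of t ^ 2))
    (ht : t.IsSwap) : IsStabilizing (K * (of t ^ 2) ^ (d / 2)) := by
  intro s₁ s₂ htype hprod
  obtain ⟨B, rfl⟩ := ofList_surjective s₂
  have h : (of t ^ 2) ^ (d / 2) = ofList (List.replicate (2 * (d / 2)) t) := by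
    rw [← pow_mul, ofList, List.map_replicate, List.prod_replicate]
  have hl : ∀ u ∈ List.replicate (2 * (d / 2)) t, u.IsSwap := fun u hu => by
    rwa [List.eq_of_mem_replicate hu]
  rw [h, mul_assoc, mul_assoc]
  refine hK.mul_ofList_mul_eq B s₁ hl (List.length_replicate ..) hl (List.length_replicate ..)
    htype ?_
  rw [hprod, prodHom_ofList]

/-! ### Hurwitz elements. -/

theorem adjSwap_isSwap (d : ℕ) (i : Fin (d - 1)) : (adjSwap d i).IsSwap :=
  ⟨_, _, by simp, rfl⟩

theorem closure_range_adjSwap (n : ℕ) :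
    Submonoid.closure (Set.range (adjSwap (n + 2))) = ⊤ :=
  mclosure_swap_castSucc_succ (n + 1)

theorem hurwitzElement_zero (d : ℕ) :
    hurwitzElement d 0 = ((List.finRange (d - 1)).map fun i => of (adjSwap d i) ^ 2).prod := by
  simp [hurwitzElement]

theorem hurwitzElement_commute (d : ℕ) (s : FactorizationSemigroup (Perm (Fin d))) :
    Commute (hurwitzElement d 0) s := by
  rw [hurwitzElement_zero]
  refine Commute.list_prod_left _ _ fun x hx => ?_
  obtain ⟨i, -, rfl⟩ := List.mem_map.1 hx
  exact of_sq_commute (swap_mul_self_of_isSwap (adjSwap_isSwap d i)) s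

theorem exists_hurwitzElement_eq (d : ℕ) (i : Fin (d - 1)) :
    ∃ s, hurwitzElement d 0 = of (adjSwap d i) ^ 2 * s := by
  obtain ⟨l, l', h⟩ := List.append_of_mem (List.mem_finRange i)
  rw [hurwitzElement_zero, h, List.map_append, List.map_cons, List.prod_append, List.prod_cons,
    ← mul_assoc, ← (of_sq_commute (swap_mul_self_of_isSwap (adjSwap_isSwap d i)) _).eq, mul_assoc]
  exact ⟨_, rfl⟩

/-- It suffices to conjugate by adjacent transpositions, each of which occurs as a letter of the
Hurwitz element, so `of_sq_mul_of` applies. -/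
theorem hurwitzElement_mul_sq_conj (n : ℕ) (g t : Perm (Fin (n + 2))) (ht : t.IsSwap) :
    hurwitzElement (n + 2) 0 * of t ^ 2 = hurwitzElement (n + 2) 0 * of (g * t * g⁻¹) ^ 2 := by
  have hg : g ∈ Submonoid.closure (Set.range (adjSwap (n + 2))) := by
    rw [closure_range_adjSwap]
    exact Submonoid.mem_top g
  induction hg using Submonoid.closure_induction generalizing t with
  | mem a ha =>
    obtain ⟨i, rfl⟩ := ha
    obtain ⟨s, hs⟩ := exists_hurwitzElement_eq (n + 2) i
    rw [hurwitzElement_commute, hurwitzElement_commute, hs, pow_two (of (adjSwap _ i)),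
      ← mul_assoc, ← mul_assoc, ← mul_assoc, ← mul_assoc,
      of_sq_mul_of (swap_mul_self_of_isSwap ht)]
  | one => simp
  | mul a b _ _ ha hb =>
    rw [hb t ht, ha _ (isSwap_conj ht b), mul_inv_rev]
    simp only [mul_assoc]

theorem hurwitzElement_absorbsSwaps (n : ℕ) :
    AbsorbsSwaps (hurwitzElement (n + 2) 0) (of (adjSwap (n + 2) (0 : Fin (n + 1))) ^ 2) where
  commute := hurwitzElement_commute _
  commute' := of_sq_commute (swap_mul_self_of_isSwap (adjSwap_isSwap (n + 2) (0 : Fin (n + 1))))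
  prodHom_eq := by
    rw [map_pow, prodHom_of, pow_two, swap_mul_self_of_isSwap (adjSwap_isSwap (n + 2) (0 : Fin (n + 1)))]
  mul_sq t ht := by
    obtain ⟨x, y, hxy, rfl⟩ := id ht
    obtain ⟨u, v, huv, h⟩ := adjSwap_isSwap (n + 2) (0 : Fin (n + 1))
    obtain ⟨g, hg⟩ := isConj_iff.1 (isConj_swap hxy huv)
    rw [hurwitzElement_mul_sq_conj n g _ ht, hg, h]

theorem hurwitzElement_eq (n g : ℕ) :
    hurwitzElement (n + 2) g =
      hurwitzElement (n + 2) 0 * (of (adjSwap (n + 2) (0 : Fin (n + 1))) ^ 2) ^ g := by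
  have h : List.finRange (n + 2 - 1) = (0 : Fin (n + 1)) :: (List.finRange n).map Fin.succ := List.finRange_succ
  have hz := (of_sq_commute (swap_mul_self_of_isSwap (adjSwap_isSwap (n + 2) (0 : Fin (n + 1))))
    (hurwitzElement (n + 2) 0)).pow_left g
  rw [← hz.eq, hurwitzElement, hurwitzElement, h]
  simp only [List.map_cons, List.prod_cons, List.map_map, Function.comp_def, Fin.val_succ,
    Nat.add_one_ne_zero, if_false, Fin.val_zero, if_true, pow_one, zero_add]
  rw [pow_succ, mul_assoc]

theorem isStabilizing_of_subsingleton {G : Type*} [Group G] [Subsingleton G]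
    (s : FactorizationSemigroup G) : IsStabilizing s := by
  have : IsEmpty {C : ConjClasses G // C ≠ 1} := by
    refine ⟨fun C => ?_⟩
    obtain ⟨C, hC⟩ := C
    obtain ⟨a, rfl⟩ := ConjClasses.exists_rep C
    exact hC (by rw [Subsingleton.elim a 1]; rfl)
  have h (s : FactorizationSemigroup G) : s = 1 :=
    eq_one_of_typeHom_eq_one (funext fun C => isEmptyElim C)
  intro s₁ s₂ _ _
  rw [h s₁, h s₂]

theorem hurwitzElement_isStabilizing (d : ℕ) : IsStabilizing (hurwitzElement d (d / 2)) := by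
  match d with
  | 0 => exact isStabilizing_of_subsingleton _
  | 1 => exact isStabilizing_of_subsingleton _
  | n + 2 =>
    rw [hurwitzElement_eq]
    exact (hurwitzElement_absorbsSwaps n).isStabilizing (adjSwap_isSwap (n + 2) (0 : Fin (n + 1)))

end Swaps

end FactorizationSemigroup

theorem corollary2p3 (d : ℕ) :
    FactorizationSemigroup.IsStabilizing (FactorizationSemigroup.hurwitzElement d (d / 2)) ∧
      FactorizationSemigroup.IsStable (Equiv.Perm (Fin d)) := by
  have h := FactorizationSemigroup.hurwitzElement_isStabilizing d
  exact ⟨h, _, h⟩
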